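/- Let $K$ be a field of characteristic $p>3$, let $S$ be a simple Lie algebra over $K$, let $n\ge 1$, and let $O_n=K[x_1,\dots,x_n]/(x_1^p,\dots,x_n^p)$ be the reduced polynomial algebra. Let $D$ be a Lie subalgebra of $W_n=\mathrm{Der}_K(O_n)$ such that the only $D$-invariant ideals of $O_n$ (ideals $I$ with $d(I)\subseteq I$ for all $d\in D$) are $0$ and $O_n$. Let $(S\otimes O_n)\oplus D$ be the semidirect sum with bracket $$[x\otimes a,\,y\otimes b]=[x,y]\otimes ab,\qquad [d,\,x\otimes a]=x\otimes d(a),\qquad [d,d']=dd'-d'd$$ for $x,y\in S$, $a,b\in O_n$, $d,d'\in D$. For a Lie algebra $L$ over $K$, let $Z^2_{\mathrm{comm}}(L)$ be the vector space of commutative $2$-cocycles on $L$, that is, of symmetric bilinear forms $\varphi:L\times L\to K$ satisfying $$\varphi([x,y],z)+\varphi([z,x],y)+\varphi([y,z],x)=0\qquad\text{for all }x,y,z\in L.$$ Then $$Z^2_{\mathrm{comm}}\big((S\otimes O_n)\oplus D\big)\simeq Z^2_{\mathrm{comm}}(D).$$ More precisely, pulling back forms along the projection $(S\otimes O_n)\oplus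 D\to D$ is a linear isomorphism from $Z^2_{\mathrm{comm}}(D)$ onto $Z^2_{\mathrm{comm}}((S\otimes O_n)\oplus D)$. -/

import Mathlib

open scoped TensorProduct

noncomputable section

/-- The space `Z²_comm(L)` of commutative 2-cocycles on a Lie algebra `L` over `K`: the symmetric
bilinear forms `φ` on `L` with `φ([x,y],z) + φ([z,x],y) + φ([y,z],x) = 0`. -/
def commCocycles (K L : Type*) [Field K] [LieRing L] [LieAlgebra K L] :
    Submodule K (LinearMap.BilinForm K L) where
  carrier := {φ | (∀ x y : L, φ x y = φ y x) ∧
    ∀ x y z : L, φ ⁅x, y⁆ z + φ ⁅z, x⁆ y + φ ⁅y, z⁆ x = 0}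
  zero_mem' := ⟨fun _ _ => rfl, fun _ _ _ => by simp⟩
  add_mem' := by
    rintro φ ψ ⟨hφ, hφ'⟩ ⟨hψ, hψ'⟩
    refine ⟨fun x y => ?_, fun x y z => ?_⟩
    · simp [hφ x y, hψ x y]
    · have h₁ := hφ' x y z
      have h₂ := hψ' x y z
      simp only [LinearMap.add_apply]
      linear_combination h₁ + h₂
  smul_mem' := by
    rintro c φ ⟨hφ, hφ'⟩
    refine ⟨fun x y => ?_, fun x y z => ?_⟩
    · simp [hφ x y]
    · have h₁ := hφ' x y z
      simp only [LinearMap.smul_apply, smul_eq_mul]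
      linear_combination c * h₁

/-- The reduced polynomial algebra `O_n = K[x₁, …, x_n] / (x₁^p, …, x_n^p)`. -/
abbrev ReducedPoly (K : Type*) [Field K] (p n : ℕ) : Type _ :=
  MvPolynomial (Fin n) K ⧸
    Ideal.span (Set.range fun i : Fin n => (MvPolynomial.X i : MvPolynomial (Fin n) K) ^ p)

/-- The Lie algebra `W_n = Der(O_n)`, with the commutator bracket. -/
abbrev WittAlg (K : Type*) [Field K] (p n : ℕ) : Type _ :=
  Derivation K (ReducedPoly K p n) (ReducedPoly K p n)

/-- An ideal `I` of a commutative algebra `A` is `D`-invariant, for a Lie algebra `D` of derivations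
of `A`, if `d(I) ⊆ I` for every `d ∈ D`. -/
def IsInvariantIdeal {K A : Type*} [Field K] [CommRing A] [Algebra K A]
    (D : LieSubalgebra K (Derivation K A A)) (I : Ideal A) : Prop :=
  ∀ d ∈ D, ∀ f ∈ I, d f ∈ I

/-- The action of a Lie algebra `D` of derivations of `A` on the current Lie algebra `A ⊗ S`
(whose bracket is `[a ⊗ x, b ⊗ y] = ab ⊗ [x, y]`) by `d • (a ⊗ x) = d(a) ⊗ x`. -/
def currentAction {K A : Type*} [Field K] [CommRing A] [Algebra K A]
    (S : Type*) [LieRing S] [LieAlgebra K S] (D : LieSubalgebra K (Derivation K A A)) :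
    D →ₗ⁅K⁆ LieDerivation K (A ⊗[K] S) (A ⊗[K] S) :=
  (Lie.Derivation.ofDerivation S).comp D.incl

/-- The Lie algebra `(S ⊗ A) ⊕ D`: the semidirect sum in which `D` acts on the ideal `S ⊗ A`
through its action on `A`. The tensor factors are written in the order `A ⊗ S`. -/
abbrev CurrentSum {K A : Type*} [Field K] [CommRing A] [Algebra K A]
    (S : Type*) [LieRing S] [LieAlgebra K S] (D : LieSubalgebra K (Derivation K A A)) : Type _ :=
  LieAlgebra.SemiDirectSum (A ⊗[K] S) D (currentAction S D)

end

/-!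
Write `A = O_n`. A commutative 2-cocycle `φ` on `(A ⊗ S) ⊕ D` comes from `D` exactly when `A ⊗ S`
lies in its kernel, and this is what has to be shown. Only two properties of the data matter:
`S` is perfect, and `A` is spanned additively by the products `a * d b` with `d ∈ D`. The latter
holds since these products span a `D`-invariant ideal; it is nonzero, for otherwise `D = 0` and
every ideal would be invariant, whereas `(x₁)` is a proper nonzero ideal.

*The restriction to `A ⊗ S`.* Put `G_a(x, y) = φ(a ⊗ x, 1 ⊗ y)`. The cocycle identity with two of
the three coefficients equal to `1` forces the skew part of `G_a` to be a skew form for which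
`G([x, y], z)` is invariant under cyclic permutations. The associated form on pairs of brackets
`([x, y], [z, w])` then satisfies the Bianchi identity, hence is symmetric under exchange of the
pairs, and it is skew because `G` is; so it vanishes
(`eq_zero_of_skew_of_lie_cyclic`), and `G_a` is a symmetric cocycle on `S`
(`symm_of_lie_cocycle`). The cocycle identity with one coefficient equal to `1` then says that
`H(x, y) = φ(a ⊗ x, b ⊗ y) - G_{ab}(x, y)` satisfies `H([z, x], y) = H(x, [z, y])`: every `ad z` is
self-adjoint for `H`. A commutator of self-adjoint operators is skew-adjoint, so `H` vanishes
(`eq_zero_of_lie_selfAdjoint`). Thus `φ(a ⊗ x, b ⊗ y) = G_{ab}(x, y)`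
(`commCocycles_tmul_tmul`).

*The mixed part.* The cocycle identity for `a ⊗ x`, `b ⊗ y`, `d` now reads
`φ(ab ⊗ [x, y], d) = G_{a d b}(x, y) - G_{b d a}(x, y)`. The left side is skew in `x, y` and the
right side symmetric, so both vanish. The left side gives `φ(A ⊗ S, D) = 0`. From the right side
with `b = 1` one gets `G_{d a} = 0`, so `G_{a d b} = -G_{b d a}` as well; hence `G_{a d b} = 0`,
and `G = 0` because such products span `A`.
-/

open scoped TensorProduct

noncomputable section

/-! ### Bilinear forms on perfect Lie algebras -/

section Perfect

variable {K L : Type*} [Field K] [LieRing L] [LieAlgebra K L]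

theorem span_lie_eq_top_of_isSimple [LieAlgebra.IsSimple K L] :
    Submodule.span K {m : L | ∃ x y : L, ⁅x, y⁆ = m} = ⊤ := by
  have hspan := LieSubmodule.lieIdeal_oper_eq_linear_span' (R := K) (⊤ : LieIdeal K L)
    (⊤ : LieIdeal K L)
  simp only [LieSubmodule.mem_top, true_and] at hspan
  rw [← hspan]
  rcases LieAlgebra.IsSimple.eq_bot_or_eq_top (R := K) ⁅(⊤ : LieIdeal K L), (⊤ : LieIdeal K L)⁆
    with h | h
  · refine absurd ⟨fun x y => ?_⟩ (LieAlgebra.IsSimple.non_abelian K (L := L))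
    have hxy := LieSubmodule.lie_mem_lie (LieSubmodule.mem_top (R := K) (L := L) x)
      (LieSubmodule.mem_top (R := K) (L := L) y)
    rwa [h, LieSubmodule.mem_bot] at hxy
  · rw [h, LieSubmodule.top_toSubmodule]

theorem LinearMap.eq_zero_of_forall_lie_eq_zero {M : Type*} [AddCommGroup M] [Module K M]
    (hL : Submodule.span K {m : L | ∃ x y : L, ⁅x, y⁆ = m} = ⊤)
    (f : L →ₗ[K] M) (hf : ∀ x y : L, f ⁅x, y⁆ = 0) : f = 0 := by
  refine LinearMap.ext_on hL ?_
  rintro _ ⟨x, y, rfl⟩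
  simpa using hf x y

/-- On a perfect Lie algebra, there is no nonzero skew form `G` for which `G ⁅x, y⁆ z` is invariant
under cyclic permutations. -/
theorem eq_zero_of_skew_of_lie_cyclic (h2 : (2 : K) ≠ 0)
    (hL : Submodule.span K {m : L | ∃ x y : L, ⁅x, y⁆ = m} = ⊤)
    (G : LinearMap.BilinForm K L) (hskew : ∀ x y, G x y = -G y x)
    (hcyc : ∀ x y z : L, G ⁅x, y⁆ z = G ⁅y, z⁆ x) : G = 0 := by
  have hneg (x y z w : L) : G ⁅x, y⁆ ⁅z, w⁆ = -G ⁅y, x⁆ ⁅z, w⁆ := by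
    rw [← lie_skew x y, map_neg, LinearMap.neg_apply]
  have hbianchi (x y z w : L) :
      G ⁅x, y⁆ ⁅z, w⁆ + G ⁅z, y⁆ ⁅w, x⁆ + G ⁅w, y⁆ ⁅x, z⁆ = 0 := by
    have hmove (u v t : L) : G ⁅u, v⁆ t = G ⁅t, u⁆ v := (hcyc t u v).symm
    rw [hmove x y, hmove z y, hmove w y, ← LinearMap.add_apply, ← LinearMap.add_apply,
      ← map_add, ← map_add]
    have hjac := lie_jacobi x z w
    have : ⁅⁅z, w⁆, x⁆ + ⁅⁅w, x⁆, z⁆ + ⁅⁅x, z⁆, w⁆ = 0 := by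
      rw [← lie_skew ⁅z, w⁆ x, ← lie_skew ⁅w, x⁆ z, ← lie_skew ⁅x, z⁆ w, ← neg_add, ← neg_add,
        hjac, neg_zero]
    rw [this, map_zero, LinearMap.zero_apply]
  have hzero (x y z w : L) : G ⁅x, y⁆ ⁅z, w⁆ = 0 := by
    have h : (2 : K) * G ⁅x, y⁆ ⁅z, w⁆ = 0 := by
      linear_combination hbianchi x y z w - hbianchi y x z w + hneg x y z w
        - (hneg z y w x - hskew ⁅y, z⁆ ⁅w, x⁆) - (hskew ⁅w, y⁆ ⁅x, z⁆ - hneg x z w y)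
    exact (mul_eq_zero.mp h).resolve_left h2
  refine LinearMap.eq_zero_of_forall_lie_eq_zero hL G fun x y => ?_
  exact LinearMap.eq_zero_of_forall_lie_eq_zero hL (G ⁅x, y⁆) (hzero x y)

/-- The hypothesis is the commutative cocycle identity with the last term transposed. It forces
symmetry, so that `G` is a commutative cocycle. -/
theorem symm_of_lie_cocycle (h2 : (2 : K) ≠ 0)
    (hL : Submodule.span K {m : L | ∃ x y : L, ⁅x, y⁆ = m} = ⊤)
    (G : LinearMap.BilinForm K L)
    (hG : ∀ x y z : L, G ⁅x, y⁆ z + G ⁅z, x⁆ y + G x ⁅y, z⁆ = 0) (x y : L) : G x y = G y x := by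
  have h : G - LinearMap.flip G = 0 := by
    refine eq_zero_of_skew_of_lie_cyclic h2 hL _ (fun x y => ?_) (fun x y z => ?_)
    · simp
    · simp only [LinearMap.sub_apply, LinearMap.flip_apply]
      linear_combination hG x y z - hG z x y
  have hxy := LinearMap.congr_fun₂ h x y
  simpa [sub_eq_zero] using hxy

/-- On a perfect Lie algebra, there is no nonzero bilinear form with respect to which every `ad z`
is self-adjoint. -/
theorem eq_zero_of_lie_selfAdjoint (h2 : (2 : K) ≠ 0)
    (hL : Submodule.span K {m : L | ∃ x y : L, ⁅x, y⁆ = m} = ⊤)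
    (H : LinearMap.BilinForm K L) (hH : ∀ x y z : L, H ⁅z, x⁆ y = H x ⁅z, y⁆) : H = 0 := by
  have had (z w x y : L) : H ⁅⁅z, w⁆, x⁆ y = 0 := by
    -- The commutator of `ad z` and `ad w` is skew-adjoint, yet it is `ad ⁅z, w⁆`.
    have hskew : H ⁅⁅z, w⁆, x⁆ y = -H ⁅⁅z, w⁆, x⁆ y := by
      conv_rhs => rw [hH, lie_lie, map_sub]
      rw [lie_lie, map_sub, LinearMap.sub_apply, hH, hH, hH, hH, neg_sub]
    exact (mul_eq_zero.mp (by linear_combination hskew : (2 : K) * _ = 0)).resolve_left h2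
  refine LinearMap.eq_zero_of_forall_lie_eq_zero hL H fun x u => LinearMap.ext fun y => ?_
  have hu : (LinearMap.flip H y) ∘ₗ LieAlgebra.ad K L x = 0 := by
    refine LinearMap.eq_zero_of_forall_lie_eq_zero hL _ fun z w => ?_
    rw [LinearMap.comp_apply, LieAlgebra.ad_apply, LinearMap.flip_apply, ← lie_skew, map_neg,
      LinearMap.neg_apply, had, neg_zero]
  exact LinearMap.congr_fun hu u

end Perfect

/-! ### Commutative cocycles on current Lie algebras -/

section Current

variable {K A S : Type*} [Field K] [CommRing A] [Algebra K A] [LieRing S] [LieAlgebra K S]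

/-- A commutative cocycle on `A ⊗ S` depends on the two coefficients from `A` only through their
product, and it is symmetric in the two arguments from the perfect Lie algebra `S`. -/
theorem commCocycles_tmul_tmul (h2 : (2 : K) ≠ 0)
    (hS : Submodule.span K {m : S | ∃ x y : S, ⁅x, y⁆ = m} = ⊤)
    {B : LinearMap.BilinForm K (A ⊗[K] S)} (hB : B ∈ commCocycles K (A ⊗[K] S))
    (a b : A) (x y : S) :
    B (a ⊗ₜ x) (b ⊗ₜ y) = B ((a * b) ⊗ₜ x) (1 ⊗ₜ y) ∧
      B (a ⊗ₜ x) (1 ⊗ₜ y) = B (a ⊗ₜ y) (1 ⊗ₜ x) := by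
  obtain ⟨hsymm, hcoc⟩ := hB
  let F (a b : A) : LinearMap.BilinForm K S :=
    B.compl₁₂ (TensorProduct.mk K A S a) (TensorProduct.mk K A S b)
  have hF (a b : A) (x y : S) : F a b x y = B (a ⊗ₜ x) (b ⊗ₜ y) := rfl
  have hFcoc (a b c : A) (x y z : S) :
      F (a * b) c ⁅x, y⁆ z + F (c * a) b ⁅z, x⁆ y + F a (b * c) x ⁅y, z⁆ = 0 := by
    have := hcoc (a ⊗ₜ x) (b ⊗ₜ y) (c ⊗ₜ z)
    simp only [LieAlgebra.ExtendScalars.bracket_tmul] at this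
    rw [hsymm ((b * c) ⊗ₜ ⁅y, z⁆)] at this
    simpa only [hF] using this
  have hG (a : A) (x y : S) : F a 1 x y = F a 1 y x :=
    symm_of_lie_cocycle h2 hS (F a 1) (fun x y z => by simpa using hFcoc a 1 1 x y z) x y
  refine ⟨?_, hG a x y⟩
  have hH : F a b - F (a * b) 1 = 0 := by
    refine eq_zero_of_lie_selfAdjoint h2 hS _ fun x y z => ?_
    have h₁ := hFcoc a b 1 x y z
    have h₂ := hFcoc (a * b) 1 1 x y z
    have h₃ (G : LinearMap.BilinForm K S) : G x ⁅z, y⁆ = -G x ⁅y, z⁆ := by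
      rw [← lie_skew z y, map_neg]
    simp only [mul_one, one_mul] at h₁ h₂
    simp only [LinearMap.sub_apply, h₃]
    linear_combination h₁ - h₂
  simpa [hF, sub_eq_zero] using LinearMap.congr_fun₂ hH x y

end Current

/-! ### Commutative cocycles on semidirect sums -/

section SemiDirect

open LieAlgebra.SemiDirectSum

variable {K A S : Type*} [Field K] [CommRing A] [Algebra K A] [LieRing S] [LieAlgebra K S]
  {D : LieSubalgebra K (Derivation K A A)}

theorem isInvariantIdeal_span_image (D : LieSubalgebra K (Derivation K A A)) :
    IsInvariantIdeal D (Ideal.span {f : A | ∃ d ∈ D, ∃ a, d a = f}) := by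
  intro d hd f hf
  induction hf using Submodule.span_induction with
  | mem f hf => exact Ideal.subset_span ⟨d, hd, f, rfl⟩
  | zero => simp
  | add f g _ _ hf hg => simpa using add_mem hf hg
  | smul a f hf ih =>
    rw [smul_eq_mul, Derivation.leibniz]
    exact add_mem (Ideal.mul_mem_left _ _ ih) (Ideal.mul_mem_right _ _ hf)

/-- A commutative cocycle on `(A ⊗ S) ⊕ D` vanishes on `A ⊗ S` when `S` is perfect and the image
of `D` generates the unit ideal of `A`. -/
theorem commCocycles_inl_eq_zero (h2 : (2 : K) ≠ 0)
    (hS : Submodule.span K {m : S | ∃ x y : S, ⁅x, y⁆ = m} = ⊤)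
    (hA : Ideal.span {f : A | ∃ d ∈ D, ∃ a, d a = f} = ⊤)
    {φ : LinearMap.BilinForm K (CurrentSum S D)} (hφ : φ ∈ commCocycles K (CurrentSum S D))
    (t : A ⊗[K] S) : φ (inl (currentAction S D) t) = 0 := by
  obtain ⟨hsymm, hcoc⟩ := hφ
  let i : A ⊗[K] S →ₗ⁅K⁆ CurrentSum S D := inl (currentAction S D)
  let j : D →ₗ⁅K⁆ CurrentSum S D := inr (currentAction S D)
  let B : LinearMap.BilinForm K (A ⊗[K] S) := φ.compl₁₂ i.toLinearMap i.toLinearMap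
  have hBi (s t : A ⊗[K] S) : B s t = φ (i s) (i t) := rfl
  have hB : B ∈ commCocycles K (A ⊗[K] S) := by
    refine ⟨fun s t => hsymm _ _, fun s t u => ?_⟩
    simpa only [hBi, LieHom.map_lie] using hcoc (i s) (i t) (i u)
  have hact (d : D) (a : A) (x : S) : ⁅j d, i (a ⊗ₜ x)⁆ = i ((d : Derivation K A A) a ⊗ₜ x) := by
    refine LieAlgebra.SemiDirectSum.ext ?_ (lie_zero d)
    change ⁅(0 : A ⊗[K] S), a ⊗ₜ x⁆ + (d : Derivation K A A) a ⊗ₜ x - currentAction S D 0 0 = _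
    rw [zero_lie, zero_add, map_zero, sub_zero]
    rfl
  have hact' (d : D) (a : A) (x : S) : ⁅i (a ⊗ₜ x), j d⁆ = -i ((d : Derivation K A A) a ⊗ₜ x) := by
    rw [← hact, lie_skew]
  let G (a : A) (x y : S) : K := B (a ⊗ₜ x) (1 ⊗ₜ y)
  have hG (a b : A) (x y : S) : B (a ⊗ₜ x) (b ⊗ₜ y) = G (a * b) x y :=
    (commCocycles_tmul_tmul h2 hS hB a b x y).1
  have hGsymm (a : A) (x y : S) : G a x y = G a y x := (commCocycles_tmul_tmul h2 hS hB a 1 x y).2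
  have hGadd (a b : A) (x y : S) : G (a + b) x y = G a x y + G b x y := by
    simp [G, TensorProduct.add_tmul]
  have hmixed (a b : A) (x y : S) (d : D) :
      φ (i ((a * b) ⊗ₜ ⁅x, y⁆)) (j d) =
        G (a * (d : Derivation K A A) b) x y - G (b * (d : Derivation K A A) a) x y := by
    have h := hcoc (i (a ⊗ₜ x)) (i (b ⊗ₜ y)) (j d)
    rw [hact, ← LieHom.map_lie, LieAlgebra.ExtendScalars.bracket_tmul, hact', map_neg,
      LinearMap.neg_apply, ← hBi, ← hBi, hG, hG, hGsymm _ y x,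
      mul_comm ((d : Derivation K A A) a), mul_comm ((d : Derivation K A A) b)] at h
    linear_combination h
  have hmixed_zero (a b : A) (x y : S) (d : D) : φ (i ((a * b) ⊗ₜ ⁅x, y⁆)) (j d) = 0 := by
    -- Exchanging `x` and `y` changes the sign on the left of `hmixed`, but not on the right.
    have h := hmixed a b y x d
    rw [hGsymm _ y x, hGsymm _ y x, ← hmixed a b x y d, ← lie_skew, TensorProduct.tmul_neg,
      map_neg, map_neg, LinearMap.neg_apply] at h
    exact (mul_eq_zero.mp (by linear_combination -h : (2 : K) * _ = 0)).resolve_left h2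
  have hright (a : A) (x : S) (d : D) : φ (i (a ⊗ₜ x)) (j d) = 0 := by
    have h : ((φ.flip (j d)) ∘ₗ i.toLinearMap) ∘ₗ TensorProduct.mk K A S a = 0 :=
      LinearMap.eq_zero_of_forall_lie_eq_zero hS _ fun x y => by
        simpa using hmixed_zero a 1 x y d
    exact LinearMap.congr_fun h x
  have hGd (a b : A) (d : D) (x y : S) : G (a * (d : Derivation K A A) b) x y = 0 := by
    have hcomm (a b : A) : G (a * (d : Derivation K A A) b) x y =
        G (b * (d : Derivation K A A) a) x y := by
      rw [← sub_eq_zero, ← hmixed, hmixed_zero]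
    have hprod : G ((d : Derivation K A A) (a * b)) x y = 0 := by
      have h := hcomm 1 (a * b)
      rw [Derivation.map_one_eq_zero, mul_zero, one_mul] at h
      simpa [G] using h
    rw [Derivation.leibniz, smul_eq_mul, smul_eq_mul, hGadd, ← hcomm a b] at hprod
    exact (mul_eq_zero.mp (by linear_combination hprod : (2 : K) * _ = 0)).resolve_left h2
  have hGzero (a : A) (x y : S) : G a x y = 0 := by
    have ha : a ∈ Ideal.span {f : A | ∃ d ∈ D, ∃ a, d a = f} := hA ▸ Submodule.mem_top
    suffices h : ∀ c, G (c * a) x y = 0 by simpa using h 1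
    induction ha using Submodule.span_induction with
    | mem f hf =>
      obtain ⟨d, hd, b, rfl⟩ := hf
      exact fun c => hGd c b ⟨d, hd⟩ x y
    | zero => exact fun c => by simp [G]
    | add f g _ _ hf hg => exact fun c => by rw [mul_add, hGadd, hf, hg, add_zero]
    | smul b f _ hf => exact fun c => by rw [smul_eq_mul, ← mul_assoc, hf]
  refine LinearMap.ext fun v => ?_
  have hv : v = i v.left + j v.right := by
    ext <;> simp [i, j]
  induction t using TensorProduct.induction_on with
  | zero => simp only [map_zero, LinearMap.zero_apply]
  | add s t hs ht => simp only [map_add, LinearMap.add_apply, hs, ht, LinearMap.zero_apply, add_zero]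
  | tmul a x =>
    rw [hv, map_add, LinearMap.zero_apply]
    change φ (i (a ⊗ₜ x)) (i v.left) + φ (i (a ⊗ₜ x)) (j v.right) = 0
    rw [hright, add_zero, ← hBi]
    induction v.left using TensorProduct.induction_on with
    | zero => simp only [map_zero]
    | add s t hs ht => simp only [map_add, hs, ht, add_zero]
    | tmul b y => rw [hG, hGzero]

/-- Pulling back along the projection to `D` is onto as soon as every commutative cocycle on
`(A ⊗ S) ⊕ D` vanishes on `A ⊗ S`. -/
theorem exists_commCocycles_equiv
    (h : ∀ φ ∈ commCocycles K (CurrentSum S D), ∀ t : A ⊗[K] S,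
      φ (inl (currentAction S D) t) = 0) :
    ∃ e : commCocycles K D ≃ₗ[K] commCocycles K (CurrentSum S D),
      ∀ (φ : commCocycles K D) (u v : CurrentSum S D),
        (e φ : LinearMap.BilinForm K (CurrentSum S D)) u v =
          (φ : LinearMap.BilinForm K D) u.right v.right := by
  let π : CurrentSum S D →ₗ⁅K⁆ D := projr (currentAction S D)
  let j : D →ₗ⁅K⁆ CurrentSum S D := inr (currentAction S D)
  have hsplit (u : CurrentSum S D) : u = inl (currentAction S D) u.left + j u.right := by
    ext <;> simp [j]
  refine ⟨
    { toFun φ := ⟨φ.1.compl₁₂ π.toLinearMap π.toLinearMap, fun u v => φ.2.1 _ _,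
        fun u v w => φ.2.2 _ _ _⟩
      invFun φ := ⟨φ.1.compl₁₂ j.toLinearMap j.toLinearMap, fun u v => φ.2.1 _ _,
        fun u v w => by simpa using φ.2.2 (j u) (j v) (j w)⟩
      map_add' _ _ := rfl
      map_smul' _ _ := rfl
      left_inv _ := rfl
      right_inv φ := ?_ }, fun _ _ _ => rfl⟩
  refine Subtype.ext (LinearMap.ext₂ fun u v => ?_)
  change φ.1 (j u.right) (j v.right) = φ.1 u v
  conv_rhs => rw [hsplit u, map_add, h φ.1 φ.2, zero_add, φ.2.1, hsplit v, map_add, h φ.1 φ.2,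
    zero_add, φ.2.1]

end SemiDirect

/-! ### Ideals of the reduced polynomial algebra -/

/-- The ideal `(x_i)` of `O_n` is neither zero nor the unit ideal: it is sent to `(ε)` under the
homomorphism to the dual numbers with `x_i ↦ ε` for every `i`. -/
theorem ReducedPoly.exists_ideal_ne_bot_ne_top (K : Type*) [Field K] {p n : ℕ} (hp : 2 ≤ p)
    (hn : 1 ≤ n) : ∃ I : Ideal (ReducedPoly K p n), I ≠ ⊥ ∧ I ≠ ⊤ := by
  let f : MvPolynomial (Fin n) K →+* DualNumber K :=
    (MvPolynomial.aeval fun _ : Fin n => (DualNumber.eps : DualNumber K)).toRingHom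
  have hfX (i : Fin n) : f (MvPolynomial.X i) = DualNumber.eps := by simp [f]
  let g : ReducedPoly K p n →+* DualNumber K := Ideal.Quotient.lift _ f fun q hq => by
    have hle : Ideal.span (Set.range fun i : Fin n =>
        (MvPolynomial.X i : MvPolynomial (Fin n) K) ^ p) ≤ RingHom.ker f := by
      rw [Ideal.span_le]
      rintro _ ⟨i, rfl⟩
      rw [SetLike.mem_coe, RingHom.mem_ker, map_pow, hfX, ← Nat.add_sub_of_le hp, pow_add,
        DualNumber.eps_pow_two, zero_mul]
    exact hle hq
  let x : ReducedPoly K p n := Ideal.Quotient.mk _ (MvPolynomial.X ⟨0, hn⟩)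
  have hgx : g x = DualNumber.eps := (Ideal.Quotient.lift_mk _ _ _).trans (hfX _)
  refine ⟨Ideal.span {x}, fun h => ?_, fun h => ?_⟩
  · rw [Ideal.span_singleton_eq_bot] at h
    have := congrArg TrivSqZeroExt.snd hgx
    simp [h] at this
  · rw [Ideal.span_singleton_eq_top] at h
    have hu := (h.map g).pow 2
    rw [hgx, DualNumber.eps_pow_two] at hu
    exact not_isUnit_zero hu

end

/-- The pull-back along the projection `(S ⊗ O_n) ⊕ D → D` is a linear isomorphism
`Z²_comm(D) ≃ Z²_comm((S ⊗ O_n) ⊕ D)`. -/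
theorem mainTheorem4 {K : Type*} [Field K] (p : ℕ) [Fact p.Prime] [CharP K p]
    (hp2 : p ≠ 2) (hp3 : p ≠ 3)
    (S : Type*) [LieRing S] [LieAlgebra K S] [LieAlgebra.IsSimple K S]
    (n : ℕ) (hn : 1 ≤ n) (D : LieSubalgebra K (WittAlg K p n))
    (hD : ∀ I : Ideal (ReducedPoly K p n), IsInvariantIdeal D I → I = ⊥ ∨ I = ⊤) :
    ∃ e : commCocycles K D ≃ₗ[K] commCocycles K (CurrentSum S D),
      ∀ (φ : commCocycles K D) (u v : CurrentSum S D),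
        (e φ : LinearMap.BilinForm K (CurrentSum S D)) u v =
          (φ : LinearMap.BilinForm K D) u.right v.right := by
  have h2 : (2 : K) ≠ 0 := Ring.two_ne_zero (by rwa [ringChar.eq K p])
  have hA : Ideal.span {f : ReducedPoly K p n | ∃ d ∈ D, ∃ a, d a = f} = ⊤ := by
    refine (hD _ (isInvariantIdeal_span_image D)).resolve_left fun hbot => ?_
    -- If `D` acts by zero, then every ideal is invariant.
    obtain ⟨I, hI, hI'⟩ := ReducedPoly.exists_ideal_ne_bot_ne_top K
      (Fact.out (p := p.Prime)).two_le hn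
    refine (hD I fun d hd f _ => ?_).elim hI hI'
    have hdf : d f = 0 := Ideal.span_eq_bot.mp hbot _ ⟨d, hd, f, rfl⟩
    exact hdf ▸ I.zero_mem
  exact exists_commCocycles_equiv fun φ hφ =>
    commCocycles_inl_eq_zero h2 span_lie_eq_top_of_isSimple hA hφ
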